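/- Let $G=(V,E)$ be a finite simple graph with $n\ge 1$ vertices. A biclique in $G$ is a pair of disjoint nonempty sets $a,b\subseteq V$ such that every vertex of $a$ is adjacent to every vertex of $b$ (edges inside $a$ or inside $b$ are allowed); its size is $|a|+|b|$. Let $\omega_b(G)$ be the maximum size of a biclique in $G$ (with $\omega_b(G)=0$ if $G$ has no edges). In the biclique game on $G$, where $G$ is fixed and known to both players, Alice gets a nonempty set $a\subseteq V$ and Bob gets a nonempty set $b\subseteq V$ such that $a\cap b=\emptyset$ and $|a|+|b|>\omega_b(G)$. The goal is to find a nonedge $\{u,v\}$ of $G$ with $u\in a$ and $v\in b$, which at the end is known to both players, that is, it is determined by the communicated bits. Let $c_b(G)$ be the minimum, over all deterministic communication protocols solving this game, of the number of bits communicated on a worst-case input $(a,b)$. **Theorem.** There is an absolute constant $C$ such that, for every $n\ge 1$ and every $n$-vertex graph $G$, $$c_b(G)\le 7.3\,\log_2 n + C .$$ If $G$ is bipartite with bipartition $V=V_1\cup V_2$, the same bound, with the same $C$, also holds for the variant of the game in which one additionally requires $a\subseteq V_1$ and $b\subseteq V_2$. -/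

import Mathlib

/-! ### Two-party communication games and deterministic protocols -/

/-- A two-party communication game: Alice gets `x : X`, Bob gets `y : Y`, the input pair is promised
to satisfy `Promise x y`, and the answer `z : Z` is correct when `Goal x y z` holds. -/
structure CommGame (X Y Z : Type*) where
  /-- the pairs of inputs that can occur -/
  Promise : X → Y → Prop
  /-- the correct answers on a pair of inputs -/
  Goal : X → Y → Z → Prop

/-- Deterministic two-party protocol trees. At an internal node one of the players, who is determined
by the node, sends one bit, which depends only on that player's own input; the play then moves to the
left (bit `false`) or to the right (bit `true`) subtree. A leaf carries the answer, so that the answer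
is determined by the communicated bits and is known to both players. -/
inductive Protocol (X Y Z : Type*) where
  | leaf (z : Z) : Protocol X Y Z
  | alice (f : X → Bool) (P₀ P₁ : Protocol X Y Z) : Protocol X Y Z
  | bob (g : Y → Bool) (P₀ P₁ : Protocol X Y Z) : Protocol X Y Z

namespace Protocol

/-- The answer given by the protocol on the input pair `(x, y)`. -/
def output {X Y Z : Type*} : Protocol X Y Z → X → Y → Z
  | leaf z, _, _ => z
  | alice f P₀ P₁, x, y => if f x then P₁.output x y else P₀.output x y
  | bob g P₀ P₁, x, y => if g y then P₁.output x y else P₀.output x y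

/-- The number of bits communicated on the input pair `(x, y)`. -/
def bits {X Y Z : Type*} : Protocol X Y Z → X → Y → ℕ
  | leaf _, _, _ => 0
  | alice f P₀ P₁, x, y => (if f x then P₁.bits x y else P₀.bits x y) + 1
  | bob g P₀ P₁, x, y => (if g y then P₁.bits x y else P₀.bits x y) + 1

/-- The protocol gives a correct answer on every input pair that satisfies the promise. -/
def Solves {X Y Z : Type*} (P : Protocol X Y Z) (Γ : CommGame X Y Z) : Prop :=
  ∀ x y, Γ.Promise x y → Γ.Goal x y (P.output x y)

/-- The number of bits communicated on a worst-case input pair of the game. -/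
noncomputable def cost {X Y Z : Type*} (P : Protocol X Y Z) (Γ : CommGame X Y Z) : ℕ∞ :=
  ⨆ (x : X) (y : Y) (_ : Γ.Promise x y), (P.bits x y : ℕ∞)

end Protocol

/-- The deterministic communication complexity of a game: the least worst-case number of bits over
all deterministic protocols that solve it (`⊤` if there is none). -/
noncomputable def CommGame.complexity {X Y Z : Type*} (Γ : CommGame X Y Z) : ℕ∞ :=
  ⨅ (P : Protocol X Y Z) (_ : P.Solves Γ), P.cost Γ

/-! ### Bicliques and the biclique game -/

namespace SimpleGraph

/-- `(a, b)` is a biclique of `G`: two disjoint nonempty sets of vertices such that every vertex of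
`a` is adjacent to every vertex of `b`. Edges inside `a` or inside `b` are allowed. -/
def IsBicliquePair {V : Type*} (G : SimpleGraph V) (a b : Finset V) : Prop :=
  a.Nonempty ∧ b.Nonempty ∧ Disjoint a b ∧ ∀ u ∈ a, ∀ v ∈ b, G.Adj u v

/-- The largest number of vertices of a biclique of `G` (`0` if `G` has no edges). -/
noncomputable def bicliqueNumber {V : Type*} (G : SimpleGraph V) : ℕ :=
  sSup {m : ℕ | ∃ a b : Finset V, G.IsBicliquePair a b ∧ a.card + b.card = m}

/-- The biclique game on `G`: Alice and Bob get disjoint nonempty sets `a` and `b` of vertices which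
together have more vertices than any biclique of `G`; a correct answer is a nonedge `{u, v}` of `G`
with `u ∈ a` and `v ∈ b`. -/
def bicliqueGame {V : Type*} (G : SimpleGraph V) : CommGame (Finset V) (Finset V) (Sym2 V) where
  Promise a b := a.Nonempty ∧ b.Nonempty ∧ Disjoint a b ∧ G.bicliqueNumber < a.card + b.card
  Goal a b e := ∃ u ∈ a, ∃ v ∈ b, ¬ G.Adj u v ∧ e = s(u, v)

/-- The biclique game on a graph with a bipartition `V₁`, `V₂`: in addition, Alice's set lies
in `V₁` and Bob's set lies in `V₂`. -/
def bipartiteBicliqueGame {V : Type*} (G : SimpleGraph V) (V₁ V₂ : Set V) :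
    CommGame (Finset V) (Finset V) (Sym2 V) where
  Promise a b := (a : Set V) ⊆ V₁ ∧ (b : Set V) ⊆ V₂ ∧ G.bicliqueGame.Promise a b
  Goal a b e := G.bicliqueGame.Goal a b e

end SimpleGraph

/-!
Let `N(b)` be the set of vertices adjacent to all of Bob's set `b`. If `|N(b)| ≥ |a|`, then `N(b)`
and `b` would form a biclique with at least `|a| + |b|` vertices, which the promise excludes. So
`|N(b)| < |a|`, and the game has the following protocol. Alice announces `k = |a|`, with about
`log₂ n` bits. The players find a vertex `u ∈ a` outside `N(b)`. Finally Bob, who knows that `u`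
is not adjacent to all of `b`, names a non-neighbour `v ∈ b` of `u`, with about `log₂ n` bits.

For the middle step, `a` is accepted and `N(b)` rejected by the threshold function `k ≤ |x|`, so
by the Karchmer–Wigderson argument (`CommGame.SolvableIn.of_formula`) it costs the depth of a
monotone formula for this function. Valiant's probabilistic construction
(`MonotoneFormula.exists_threshold`) gives depth `5.3 log₂ n + O(1)`, for a total of
`7.3 log₂ n + O(1)`.

In that construction a random variable or constant accepts `x` with probability at least
`p + 1 / (6 n)` when `k ≤ |x|` and at most `p - 1 / (6 n)` otherwise, where `p = (3 - √5) / 2` is the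
repelling fixed point of `q ↦ (1 - (1 - q) ^ 2) ^ 2`. This map describes the passage from a random
formula to a conjunction of two disjunctions of independent copies of it, which adds `2` to the
depth. The distance to `p` grows by a factor of at least `1.523` per step until it is constant,
which takes `2 log₂ n / log₂ 1.523 ≤ 3.3 log₂ n` levels; then the error probability is essentially
squared in every step, and `2 log₂ n` more levels make it smaller than `2 ^ (-n)`. A union bound
over all `x` yields a formula without errors.
-/

/-! ### Solving a game within a number of bits -/

namespace CommGame

variable {X Y Z : Type*}

/-- Some protocol solves the game and sends at most `t` bits on every promised input pair. -/
def SolvableIn (Γ : CommGame X Y Z) (t : ℕ) : Prop :=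
  ∃ P : Protocol X Y Z, P.Solves Γ ∧ ∀ x y, Γ.Promise x y → P.bits x y ≤ t

/-- The game `Γ` with the promise strengthened by `Q`. -/
def restrict (Γ : CommGame X Y Z) (Q : X → Y → Prop) : CommGame X Y Z where
  Promise x y := Γ.Promise x y ∧ Q x y
  Goal := Γ.Goal

theorem SolvableIn.complexity_le {Γ : CommGame X Y Z} {t : ℕ} (h : Γ.SolvableIn t) :
    Γ.complexity ≤ t := by
  obtain ⟨P, hP, hb⟩ := h
  refine (iInf₂_le P hP).trans ?_
  refine iSup_le fun x => iSup_le fun y => iSup_le fun hxy => ?_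
  exact_mod_cast hb x y hxy

theorem SolvableIn.of_imp {Γ Δ : CommGame X Y Z} {t : ℕ} (h : Γ.SolvableIn t)
    (hprom : ∀ x y, Δ.Promise x y → Γ.Promise x y)
    (hgoal : ∀ x y z, Γ.Goal x y z → Δ.Goal x y z) : Δ.SolvableIn t := by
  obtain ⟨P, hP, hb⟩ := h
  exact ⟨P, fun x y hxy => hgoal _ _ _ (hP x y (hprom x y hxy)), fun x y hxy =>
    hb x y (hprom x y hxy)⟩

theorem SolvableIn.mono {Γ : CommGame X Y Z} {s t : ℕ} (h : Γ.SolvableIn s) (hst : s ≤ t) :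
    Γ.SolvableIn t := by
  obtain ⟨P, hP, hb⟩ := h
  exact ⟨P, hP, fun x y hxy => (hb x y hxy).trans hst⟩

theorem solvableIn_zero_of_goal {Γ : CommGame X Y Z} (z : Z)
    (h : ∀ x y, Γ.Promise x y → Γ.Goal x y z) : Γ.SolvableIn 0 :=
  ⟨.leaf z, h, fun _ _ _ => le_rfl⟩

theorem SolvableIn.alice_bit {Γ : CommGame X Y Z} {t : ℕ} (f : X → Bool)
    (h : ∀ c, (Γ.restrict fun x _ => f x = c).SolvableIn t) : Γ.SolvableIn (t + 1) := by
  obtain ⟨P₀, h₀, b₀⟩ := h false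
  obtain ⟨P₁, h₁, b₁⟩ := h true
  refine ⟨.alice f P₀ P₁, fun x y hxy => ?_, fun x y hxy => ?_⟩
  · cases hf : f x
    · simpa [Protocol.output, restrict, hf] using h₀ x y ⟨hxy, hf⟩
    · simpa [Protocol.output, restrict, hf] using h₁ x y ⟨hxy, hf⟩
  · cases hf : f x
    · simpa [Protocol.bits, hf] using b₀ x y ⟨hxy, hf⟩
    · simpa [Protocol.bits, hf] using b₁ x y ⟨hxy, hf⟩

theorem SolvableIn.bob_bit {Γ : CommGame X Y Z} {t : ℕ} (g : Y → Bool)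
    (h : ∀ c, (Γ.restrict fun _ y => g y = c).SolvableIn t) : Γ.SolvableIn (t + 1) := by
  obtain ⟨P₀, h₀, b₀⟩ := h false
  obtain ⟨P₁, h₁, b₁⟩ := h true
  refine ⟨.bob g P₀ P₁, fun x y hxy => ?_, fun x y hxy => ?_⟩
  · cases hg : g y
    · simpa [Protocol.output, restrict, hg] using h₀ x y ⟨hxy, hg⟩
    · simpa [Protocol.output, restrict, hg] using h₁ x y ⟨hxy, hg⟩
  · cases hg : g y
    · simpa [Protocol.bits, hg] using b₀ x y ⟨hxy, hg⟩
    · simpa [Protocol.bits, hg] using b₁ x y ⟨hxy, hg⟩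

/-- Alice can announce a number below `2 ^ d` with `d` bits. -/
theorem SolvableIn.alice_nat {t : ℕ} (d : ℕ) {Γ : CommGame X Y Z} (f : X → ℕ)
    (hf : ∀ x y, Γ.Promise x y → f x < 2 ^ d)
    (h : ∀ c, (Γ.restrict fun x _ => f x = c).SolvableIn t) : Γ.SolvableIn (t + d) := by
  induction d generalizing Γ f with
  | zero =>
    refine (h 0).of_imp (fun x y hxy => ⟨hxy, ?_⟩) fun _ _ _ hz => hz
    simpa using hf x y hxy
  | succ d ih =>
    refine SolvableIn.alice_bit (fun x => decide (f x % 2 = 1)) fun c => ?_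
    refine ih (fun x => f x / 2) (fun x y hxy => ?_) fun m => ?_
    · have := hf x y hxy.1
      rw [pow_succ] at this
      exact Nat.div_lt_of_lt_mul (by omega)
    · refine (h (2 * m + c.toNat)).of_imp (fun x y hxy => ⟨hxy.1.1, ?_⟩) fun _ _ _ hz => hz
      have h₁ := hxy.1.2
      have h₂ := hxy.2
      cases c <;> simp at h₁ h₂ ⊢ <;> omega

/-- Bob can announce a number below `2 ^ d` with `d` bits. -/
theorem SolvableIn.bob_nat {t : ℕ} (d : ℕ) {Γ : CommGame X Y Z} (g : Y → ℕ)
    (hg : ∀ x y, Γ.Promise x y → g y < 2 ^ d)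
    (h : ∀ c, (Γ.restrict fun _ y => g y = c).SolvableIn t) : Γ.SolvableIn (t + d) := by
  induction d generalizing Γ g with
  | zero =>
    refine (h 0).of_imp (fun x y hxy => ⟨hxy, ?_⟩) fun _ _ _ hz => hz
    simpa using hg x y hxy
  | succ d ih =>
    refine SolvableIn.bob_bit (fun y => decide (g y % 2 = 1)) fun c => ?_
    refine ih (fun y => g y / 2) (fun x y hxy => ?_) fun m => ?_
    · have := hg x y hxy.1
      rw [pow_succ] at this
      exact Nat.div_lt_of_lt_mul (by omega)
    · refine (h (2 * m + c.toNat)).of_imp (fun x y hxy => ⟨hxy.1.1, ?_⟩) fun _ _ _ hz => hz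
      have h₁ := hxy.1.2
      have h₂ := hxy.2
      cases c <;> simp at h₁ h₂ ⊢ <;> omega

end CommGame

/-! ### Monotone formulas and the Karchmer–Wigderson protocol -/

/-- Monotone Boolean formulas over `∧` and `∨` with variables indexed by `V` and both constants. -/
inductive MonotoneFormula (V : Type*) where
  | var (i : V) : MonotoneFormula V
  | const (c : Bool) : MonotoneFormula V
  | and (φ ψ : MonotoneFormula V) : MonotoneFormula V
  | or (φ ψ : MonotoneFormula V) : MonotoneFormula V

namespace MonotoneFormula

/-- The formula accepts `x`: it is true when exactly the variables in `x` are set to true. -/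
def Accepts {V : Type*} : MonotoneFormula V → Finset V → Prop
  | var i, x => i ∈ x
  | const c, _ => c = true
  | and φ ψ, x => φ.Accepts x ∧ ψ.Accepts x
  | or φ ψ, x => φ.Accepts x ∨ ψ.Accepts x

/-- The depth of the formula; variables and constants have depth `0`. -/
def depth {V : Type*} : MonotoneFormula V → ℕ
  | var _ => 0
  | const _ => 0
  | and φ ψ => max φ.depth ψ.depth + 1
  | or φ ψ => max φ.depth ψ.depth + 1

end MonotoneFormula

open Classical in
/-- **Karchmer–Wigderson.** If a monotone formula accepts Alice's set `A x` and rejects Bob's set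
`B y`, the players can walk down the formula, with one bit per level, to a variable in
`A x \ B y`. -/
theorem CommGame.SolvableIn.of_formula {V X Y Z : Type*} [Nonempty Z] {t : ℕ}
    (φ : MonotoneFormula V) (A : X → Finset V) (B : Y → Finset V) {Γ : CommGame X Y Z}
    (hA : ∀ x y, Γ.Promise x y → φ.Accepts (A x))
    (hB : ∀ x y, Γ.Promise x y → ¬ φ.Accepts (B y))
    (h : ∀ i, (Γ.restrict fun x y => i ∈ A x ∧ i ∉ B y).SolvableIn t) :
    Γ.SolvableIn (t + φ.depth) := by
  induction φ generalizing Γ with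
  | var i =>
    exact (h i).of_imp (fun x y hxy => ⟨hxy, hA x y hxy, hB x y hxy⟩) fun _ _ _ hz => hz
  | const c =>
    refine SolvableIn.mono (solvableIn_zero_of_goal (Classical.arbitrary Z) fun x y hxy => ?_)
      (Nat.zero_le _)
    exact absurd (hA x y hxy) (hB x y hxy)
  | and φ ψ ihφ ihψ =>
    refine SolvableIn.bob_bit (t := t + max φ.depth ψ.depth)
      (fun y => decide (φ.Accepts (B y))) fun c => ?_
    cases c
    · refine SolvableIn.mono (ihφ (fun x y hxy => (hA x y hxy.1).1)
        (fun x y hxy => by simpa using hxy.2) fun i => ?_)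
        (Nat.add_le_add_left (le_max_left _ _) t)
      exact (h i).of_imp (fun x y hxy => ⟨hxy.1.1, hxy.2⟩) fun _ _ _ hz => hz
    · refine SolvableIn.mono (ihψ (fun x y hxy => (hA x y hxy.1).2)
        (fun x y hxy hψ => hB x y hxy.1 ⟨by simpa using hxy.2, hψ⟩) fun i => ?_)
        (Nat.add_le_add_left (le_max_right _ _) t)
      exact (h i).of_imp (fun x y hxy => ⟨hxy.1.1, hxy.2⟩) fun _ _ _ hz => hz
  | or φ ψ ihφ ihψ =>
    refine SolvableIn.alice_bit (t := t + max φ.depth ψ.depth)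
      (fun x => decide (¬ φ.Accepts (A x))) fun c => ?_
    cases c
    · refine SolvableIn.mono (ihφ (fun x y hxy => by simpa using hxy.2)
        (fun x y hxy hφ => hB x y hxy.1 (Or.inl hφ)) fun i => ?_)
        (Nat.add_le_add_left (le_max_left _ _) t)
      exact (h i).of_imp (fun x y hxy => ⟨hxy.1.1, hxy.2⟩) fun _ _ _ hz => hz
    · refine SolvableIn.mono (ihψ
        (fun x y hxy => (hA x y hxy.1).resolve_left (by simpa using hxy.2))
        (fun x y hxy hψ => hB x y hxy.1 (Or.inr hψ)) fun i => ?_)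
        (Nat.add_le_add_left (le_max_right _ _) t)
      exact (h i).of_imp (fun x y hxy => ⟨hxy.1.1, hxy.2⟩) fun _ _ _ hz => hz

/-! ### Random monotone formulas -/

/-- The probability that a conjunction of two disjunctions of independent events of probability `p`
holds. -/
def amplify (p : ℝ) : ℝ := (1 - (1 - p) ^ 2) ^ 2

universe u

/-- A random monotone formula: a finite sample space `Ω` with probability weights, and a formula for
each sample point. -/
structure RandomFormula (V : Type u) where
  /-- the sample space -/
  Ω : Type u
  [fintype : Fintype Ω]
  /-- the probability of a sample point -/
  wt : Ω → ℝ
  wt_nonneg : ∀ ω, 0 ≤ wt ω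
  sum_wt : ∑ ω, wt ω = 1
  /-- the formula at a sample point -/
  formula : Ω → MonotoneFormula V

namespace RandomFormula

attribute [instance] RandomFormula.fintype

variable {V : Type u}

open Classical in
/-- The probability that the random formula accepts `x`. -/
noncomputable def acceptProb (R : RandomFormula V) (x : Finset V) : ℝ :=
  ∑ ω, if (R.formula ω).Accepts x then R.wt ω else 0

open Classical in
theorem one_sub_acceptProb (R : RandomFormula V) (x : Finset V) :
    1 - R.acceptProb x = ∑ ω, if (R.formula ω).Accepts x then 0 else R.wt ω := by
  rw [← R.sum_wt, acceptProb, ← Finset.sum_sub_distrib]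
  refine Finset.sum_congr rfl fun ω _ => ?_
  split_ifs <;> simp

/-- Combine two independent copies of a random formula by a binary operation. -/
def combine (R : RandomFormula V)
    (op : MonotoneFormula V → MonotoneFormula V → MonotoneFormula V) : RandomFormula V where
  Ω := R.Ω × R.Ω
  wt ω := R.wt ω.1 * R.wt ω.2
  wt_nonneg ω := mul_nonneg (R.wt_nonneg _) (R.wt_nonneg _)
  sum_wt := by
    rw [Fintype.sum_prod_type, ← Fintype.sum_mul_sum, R.sum_wt, one_mul]
  formula ω := op (R.formula ω.1) (R.formula ω.2)

theorem acceptProb_combine_and (R : RandomFormula V) (x : Finset V) :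
    (R.combine .and).acceptProb x = R.acceptProb x ^ 2 := by
  classical
  rw [sq, acceptProb, acceptProb, Fintype.sum_mul_sum]
  refine (Fintype.sum_prod_type _).trans ?_
  refine Finset.sum_congr rfl fun i _ => Finset.sum_congr rfl fun j _ => ?_
  by_cases hi : (R.formula i).Accepts x <;> by_cases hj : (R.formula j).Accepts x <;>
    simp [combine, MonotoneFormula.Accepts, hi, hj]

theorem acceptProb_combine_or (R : RandomFormula V) (x : Finset V) :
    (R.combine .or).acceptProb x = 1 - (1 - R.acceptProb x) ^ 2 := by
  classical
  rw [eq_sub_iff_add_eq, ← eq_sub_iff_add_eq', sq, one_sub_acceptProb, one_sub_acceptProb,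
    Fintype.sum_mul_sum]
  refine Eq.symm ((Fintype.sum_prod_type _).trans ?_)
  refine Finset.sum_congr rfl fun i _ => Finset.sum_congr rfl fun j _ => ?_
  by_cases hi : (R.formula i).Accepts x <;> by_cases hj : (R.formula j).Accepts x <;>
    simp [combine, MonotoneFormula.Accepts, hi, hj]

theorem exists_iterate_amplify (R : RandomFormula V) (hR : ∀ ω, (R.formula ω).depth = 0) (k : ℕ) :
    ∃ S : RandomFormula V, (∀ ω, (S.formula ω).depth ≤ 2 * k) ∧
      ∀ x, S.acceptProb x = amplify^[k] (R.acceptProb x) := by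
  induction k with
  | zero => exact ⟨R, fun ω => (hR ω).le, fun x => rfl⟩
  | succ k ih =>
    obtain ⟨S, hd, hp⟩ := ih
    refine ⟨(S.combine .or).combine .and, fun ω => ?_, fun x => ?_⟩
    · have h₁ := hd ω.1.1
      have h₂ := hd ω.1.2
      have h₃ := hd ω.2.1
      have h₄ := hd ω.2.2
      simp only [combine, MonotoneFormula.depth]
      omega
    · rw [acceptProb_combine_and, acceptProb_combine_or, hp, Function.iterate_succ_apply']
      rfl

theorem acceptProb_nonneg (R : RandomFormula V) (x : Finset V) : 0 ≤ R.acceptProb x :=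
  Finset.sum_nonneg fun ω _ => by split_ifs <;> simp [R.wt_nonneg]

theorem acceptProb_le_one (R : RandomFormula V) (x : Finset V) : R.acceptProb x ≤ 1 := by
  rw [← sub_nonneg, one_sub_acceptProb]
  exact Finset.sum_nonneg fun ω _ => by split_ifs <;> simp [R.wt_nonneg]

/-- The union bound: a random formula which errs on each set with probability below `2 ^ (-|V|)`
has a sample point at which it errs nowhere. -/
theorem exists_forall_accepts_iff [Fintype V] (R : RandomFormula V) (T : Finset V → Prop)
    (hacc : ∀ x, T x → 1 - R.acceptProb x < (1 / 2) ^ Fintype.card V)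
    (hrej : ∀ x, ¬ T x → R.acceptProb x < (1 / 2) ^ Fintype.card V) :
    ∃ ω, ∀ x, (R.formula ω).Accepts x ↔ T x := by
  classical
  by_contra! hcon
  -- `err x` is the probability of an error on `x`
  let err : Finset V → ℝ := fun x => ∑ ω, if (R.formula ω).Accepts x ↔ T x then 0 else R.wt ω
  have herr : ∀ x, err x < (1 / 2) ^ Fintype.card V := by
    intro x
    by_cases hx : T x
    · simpa [err, hx, one_sub_acceptProb] using hacc x hx
    · simpa [err, hx, acceptProb, ite_not] using hrej x hx
  have hlt : ∑ x, err x < 1 := by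
    calc ∑ x, err x < ∑ _x : Finset V, (1 / 2 : ℝ) ^ Fintype.card V :=
          Finset.sum_lt_sum_of_nonempty Finset.univ_nonempty fun x _ => herr x
      _ = 1 := by
          rw [Finset.sum_const, Finset.card_univ, Fintype.card_finset, nsmul_eq_mul, Nat.cast_pow,
            ← mul_pow]
          norm_num
  have hge : 1 ≤ ∑ x, err x := by
    rw [Finset.sum_comm, ← R.sum_wt]
    refine Finset.sum_le_sum fun ω _ => ?_
    obtain ⟨x, hx⟩ := hcon ω
    have hx' : ¬ ((R.formula ω).Accepts x ↔ T x) := by tauto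
    calc R.wt ω = if (R.formula ω).Accepts x ↔ T x then 0 else R.wt ω := by rw [if_neg hx']
      _ ≤ _ := Finset.single_le_sum
          (f := fun x => if (R.formula ω).Accepts x ↔ T x then 0 else R.wt ω)
          (fun y _ => by split_ifs <;> simp [R.wt_nonneg]) (Finset.mem_univ x)
  exact absurd hlt hge.not_gt

/-- A random variable or constant whose acceptance probability is affine in `|x|`, with slope
`1 / (3 |V|)`, and equals `p` at the (non-integral) size `|x| = k - 1 / 2`. -/
theorem exists_acceptProb_eq [Fintype V] [Nonempty V] {p : ℝ} (hp : 1 / 3 ≤ p) (hp' : p ≤ 2 / 3)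
    {k : ℕ} (hk : 1 ≤ k) (hkn : k ≤ Fintype.card V) :
    ∃ R : RandomFormula V, (∀ ω, (R.formula ω).depth = 0) ∧
      ∀ x : Finset V, R.acceptProb x = p + (x.card - k + 1 / 2) / (3 * Fintype.card V) := by
  have hn : (0 : ℝ) < Fintype.card V := by exact_mod_cast Fintype.card_pos
  have hk1 : (1 : ℝ) ≤ k := by exact_mod_cast hk
  have hkn' : (k : ℝ) ≤ Fintype.card V := by exact_mod_cast hkn
  set n : ℝ := (Fintype.card V : ℝ) with hndef
  set s : ℝ := (k - 1 / 2) / (3 * n) with hs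
  have hs0 : 0 ≤ s := by rw [hs]; apply div_nonneg <;> linarith
  have hs1 : s ≤ 1 / 3 := by rw [hs, div_le_iff₀ (by linarith)]; linarith
  have hsum : n * (1 / (3 * n)) = 1 / 3 := by field_simp
  let R : RandomFormula V :=
    { Ω := V ⊕ Bool
      wt := Sum.elim (fun _ => 1 / (3 * n)) fun c => if c then p - s else 2 / 3 - (p - s)
      wt_nonneg := by
        rintro (i | c)
        · simp only [Sum.elim_inl]; positivity
        · cases c <;> simp <;> linarith
      sum_wt := by
        simp only [Fintype.sum_sum_type, Sum.elim_inl, Sum.elim_inr, Fintype.sum_bool,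
          Finset.sum_const, Finset.card_univ, nsmul_eq_mul, ← hndef, hsum]
        norm_num
      formula := Sum.elim .var .const }
  refine ⟨R, ?_, fun x => ?_⟩
  · rintro (i | c) <;> rfl
  · classical
    have : R.acceptProb x = x.card * (1 / (3 * n)) + (p - s) := by
      simp [acceptProb, R, MonotoneFormula.Accepts, Finset.sum_ite_mem]
    rw [this, hs]
    field_simp
    ring

end RandomFormula

/-! ### Iterating the amplification map -/

theorem min_le_of_geometric_growth {g : ℕ → ℝ} {r c : ℝ} (hr : 1 ≤ r) (hc : 0 ≤ c)
    (hmono : ∀ j, g j ≤ g (j + 1)) (hgrow : ∀ j, g j ≤ c → r * g j ≤ g (j + 1)) (j : ℕ) :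
    min c (r ^ j * g 0) ≤ g j := by
  induction j with
  | zero => simp
  | succ j ih =>
    rcases le_total c (g j) with h | h
    · exact (min_le_left _ _).trans (h.trans (hmono j))
    · refine le_trans ?_ (hgrow j h)
      refine le_trans ?_ (mul_le_mul_of_nonneg_left ih (by linarith))
      rw [mul_min_of_nonneg _ _ (by linarith), pow_succ', mul_assoc]
      exact min_le_min_right _ (by nlinarith)

/-- A root `p` of `p ^ 2 - 3 * p + 1` is a fixed point of `amplify`, and one step of `amplify`
multiplies the displacement from `p` by the factor on the right, which is at least `1` on `[0, 1]`
when `p = (3 - √5) / 2`. -/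
theorem amplify_sub_fixed {p : ℝ} (hp : p ^ 2 = 3 * p - 1) (x : ℝ) :
    amplify x - p = (x - p) * (1 + x * (1 - x) * (3 - p - x)) := by
  unfold amplify
  linear_combination -(x - x ^ 2) * hp

theorem amplify_mem_unit {x : ℝ} (h0 : 0 ≤ x) (h1 : x ≤ 1) : 0 ≤ amplify x ∧ amplify x ≤ 1 := by
  have h2 : (1 - x) ^ 2 ≤ 1 := pow_le_one₀ (by linarith) (by linarith)
  exact ⟨sq_nonneg _, pow_le_one₀ (by linarith) (by linarith [sq_nonneg (1 - x)])⟩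

theorem iterate_amplify_mem_unit {x : ℝ} (h0 : 0 ≤ x) (h1 : x ≤ 1) (k : ℕ) :
    0 ≤ amplify^[k] x ∧ amplify^[k] x ≤ 1 := by
  induction k with
  | zero => exact ⟨h0, h1⟩
  | succ k ih =>
    rw [Function.iterate_succ_apply']
    exact amplify_mem_unit ih.1 ih.2

theorem mul_abs_sub_le_abs_amplify_sub {p : ℝ} (hp : p ^ 2 = 3 * p - 1) {x r : ℝ} (hr : 1 ≤ r)
    (h : r ≤ 1 + x * (1 - x) * (3 - p - x)) : r * |x - p| ≤ |amplify x - p| := by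
  rw [amplify_sub_fixed hp, abs_mul, abs_of_pos (by linarith : 0 < 1 + x * (1 - x) * (3 - p - x)),
    mul_comm]
  exact mul_le_mul_of_nonneg_left h (abs_nonneg _)

theorem amplify_factor_nonneg {p x : ℝ} (h₂ : p < 0.382) (h0 : 0 ≤ x) (h1 : x ≤ 1) :
    0 ≤ x * (1 - x) * (3 - p - x) :=
  mul_nonneg (mul_nonneg h0 (by linarith)) (by linarith)

/-- Near the fixed point one step of `amplify` multiplies the distance to it by at least `1.523`.
The derivative of `amplify` at the fixed point is `1.527…`; any factor whose binary logarithm is at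
least `2 / 3.3` is good enough. -/
theorem le_abs_iterate_amplify_sub {p : ℝ} (hp : p ^ 2 = 3 * p - 1) (h₁ : 0.3819 < p)
    (h₂ : p < 0.382) {x : ℝ} (h0 : 0 ≤ x) (h1 : x ≤ 1) {j : ℕ}
    (hj : 1 / 100 ≤ 1.523 ^ j * |x - p|) : 1 / 100 ≤ |amplify^[j] x - p| := by
  have key := min_le_of_geometric_growth (g := fun k => |amplify^[k] x - p|) (r := 1.523)
    (c := 1 / 100) (by norm_num) (by norm_num) ?_ ?_ j
  · exact (le_min le_rfl hj).trans key
  · intro k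
    obtain ⟨h0', h1'⟩ := iterate_amplify_mem_unit h0 h1 k
    have := mul_abs_sub_le_abs_amplify_sub hp le_rfl
      (le_add_of_nonneg_right (amplify_factor_nonneg h₂ h0' h1'))
    simpa only [Function.iterate_succ_apply', one_mul] using this
  · intro k hk
    simp only [Function.iterate_succ_apply'] at hk ⊢
    set y := amplify^[k] x
    obtain ⟨hy₁, hy₂⟩ := abs_le.1 hk
    refine mul_abs_sub_le_abs_amplify_sub hp (by norm_num) ?_
    have hA : (0.371 : ℝ) < y := by linarith
    have hB : y < 0.393 := by linarith
    -- `y * (1 - y)` is concave, hence above its chord on `[0.371, 0.393]`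
    have hC : 0.233359 + (0.238551 - 0.233359) / 0.022 * (y - 0.371) ≤ y * (1 - y) := by
      nlinarith [mul_nonneg (sub_nonneg.2 hA.le) (sub_nonneg.2 hB.le)]
    have hD : 0 < 3 - p - y := by linarith
    nlinarith [mul_nonneg (sub_nonneg.2 hC) hD.le]

theorem iterate_amplify_le_fixed_iff {p : ℝ} (hp : p ^ 2 = 3 * p - 1) (h₂ : p < 0.382) {x : ℝ}
    (h0 : 0 ≤ x) (h1 : x ≤ 1) (k : ℕ) : amplify^[k] x ≤ p ↔ x ≤ p := by
  induction k with
  | zero => rfl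
  | succ k ih =>
    obtain ⟨h0', h1'⟩ := iterate_amplify_mem_unit h0 h1 k
    have h := amplify_factor_nonneg h₂ h0' h1'
    have hpos : 0 < 1 + amplify^[k] x * (1 - amplify^[k] x) * (3 - p - amplify^[k] x) := by
      linarith
    rw [← ih, Function.iterate_succ_apply', ← sub_nonpos, amplify_sub_fixed hp,
      ← sub_nonpos (b := p)]
    exact ⟨fun h => not_lt.1 fun h' => h.not_gt (mul_pos h' hpos),
      fun h => mul_nonpos_of_nonpos_of_nonneg h hpos.le⟩

/-- From a constant distance to the fixed point, constantly many steps lead close to `0` or `1`: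
between `1 / 16` and `15 / 16` every step multiplies the distance by at least `1.03`, so the count
`160` only has to satisfy `1.03 ^ 160 > 100`. -/
theorem iterate_amplify_le_or_ge {p : ℝ} (hp : p ^ 2 = 3 * p - 1) (h₁ : 0.3819 < p)
    (h₂ : p < 0.382) {x : ℝ} (h0 : 0 ≤ x) (h1 : x ≤ 1) (hx : 1 / 100 ≤ |x - p|) :
    amplify^[160] x ≤ 1 / 16 ∨ 15 / 16 ≤ amplify^[160] x := by
  have key : ∀ k : ℕ, amplify^[k] x ≤ 1 / 16 ∨ 15 / 16 ≤ amplify^[k] x ∨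
      1.03 ^ k * (1 / 100) ≤ |amplify^[k] x - p| := by
    intro k
    induction k with
    | zero => exact Or.inr (Or.inr (by simpa using hx))
    | succ k ih =>
      rw [Function.iterate_succ_apply']
      obtain ⟨h0', h1'⟩ := iterate_amplify_mem_unit h0 h1 k
      set y := amplify^[k] x
      have hf := amplify_factor_nonneg h₂ h0' h1'
      have hfix := amplify_sub_fixed hp y
      rcases le_or_gt y (1 / 16) with hlo | hlo
      · left; nlinarith
      rcases le_or_gt (15 / 16) y with hhi | hhi
      · right; left; nlinarith
      have ih' := (ih.resolve_left hlo.not_ge).resolve_left hhi.not_ge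
      right; right
      have hyy : 15 / 256 ≤ y * (1 - y) := by nlinarith
      refine le_trans ?_ (mul_abs_sub_le_abs_amplify_sub hp (r := 1.03) (by norm_num) ?_)
      · rw [pow_succ', mul_assoc]
        exact mul_le_mul_of_nonneg_left ih' (by norm_num)
      · nlinarith
  rcases key 160 with h | h | h
  · exact Or.inl h
  · exact Or.inr h
  · obtain ⟨h0', h1'⟩ := iterate_amplify_mem_unit h0 h1 160
    have h2 : |amplify^[160] x - p| ≤ 1 := abs_le.2 ⟨by linarith, by linarith⟩
    have h3 : (1 : ℝ) < 1.03 ^ 160 * (1 / 100) := by norm_num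
    linarith

theorem amplify_iterate_small {u : ℝ} (h0 : 0 ≤ u) (h1 : u ≤ 1 / 16) (i : ℕ) :
    0 ≤ amplify^[i] u ∧ 4 * amplify^[i] u ≤ (1 / 4) ^ 2 ^ i := by
  induction i with
  | zero => simp; constructor <;> linarith
  | succ i ih =>
    rw [Function.iterate_succ_apply', pow_succ, pow_mul]
    set v := amplify^[i] u
    have hv : v ≤ 1 := by
      have : ((1 : ℝ) / 4) ^ 2 ^ i ≤ 1 := pow_le_one₀ (by norm_num) (by norm_num)
      linarith
    refine ⟨by unfold amplify; positivity, ?_⟩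
    calc 4 * amplify v = (4 * v) ^ 2 * (1 - v / 2) ^ 2 := by unfold amplify; ring
      _ ≤ (4 * v) ^ 2 * 1 := by
          refine mul_le_mul_of_nonneg_left ?_ (sq_nonneg _)
          exact pow_le_one₀ (by linarith) (by linarith [ih.1])
      _ ≤ _ := by rw [mul_one]; exact pow_le_pow_left₀ (by linarith [ih.1]) ih.2 2

theorem amplify_iterate_large {u : ℝ} (h0 : u ≤ 1) (h1 : 15 / 16 ≤ u) (i : ℕ) :
    0 ≤ 1 - amplify^[i] u ∧ 4 * (1 - amplify^[i] u) ≤ (1 / 4) ^ 2 ^ i := by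
  induction i with
  | zero => simp; constructor <;> linarith
  | succ i ih =>
    rw [Function.iterate_succ_apply', pow_succ, pow_mul]
    set v := amplify^[i] u
    have hv : 1 - v ≤ 1 := by
      have : ((1 : ℝ) / 4) ^ 2 ^ i ≤ 1 := pow_le_one₀ (by norm_num) (by norm_num)
      linarith
    have hq : 1 - amplify v = (1 - v) ^ 2 * (2 - (1 - v) ^ 2) := by unfold amplify; ring
    have hq1 : (1 - v) ^ 2 ≤ 1 := pow_le_one₀ ih.1 hv
    have hsq := pow_le_pow_left₀ (by linarith [ih.1]) ih.2 2
    rw [hq]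
    constructor
    · exact mul_nonneg (sq_nonneg _) (by linarith)
    · nlinarith [sq_nonneg (1 - v)]

/-- Starting at distance at least `1 / (6 n)` from the fixed point, the iterates get within
`2 ^ (-n)` of `0` or of `1`, depending on the side: `j` steps reach a constant distance from the
fixed point, `160` steps lead on to the quadratic regime near `0` or `1`, and `i` steps of squaring
finish. -/
theorem iterate_amplify_extreme {p : ℝ} (hp : p ^ 2 = 3 * p - 1) (h₁ : 0.3819 < p)
    (h₂ : p < 0.382) {x : ℝ} (h0 : 0 ≤ x) (h1 : x ≤ 1) {n i j : ℕ} (hn : 0 < n)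
    (hx : 1 / (6 * n) ≤ |x - p|) (hj : (n : ℝ) ≤ 1.523 ^ j) (hi : n ≤ 2 ^ i) :
    (x ≤ p → amplify^[i + (160 + j)] x < (1 / 2) ^ n) ∧
      (p < x → 1 - amplify^[i + (160 + j)] x < (1 / 2) ^ n) := by
  have hn' : (0 : ℝ) < n := by exact_mod_cast hn
  have hgap : 1 / 100 ≤ 1.523 ^ j * |x - p| := by
    calc (1 / 100 : ℝ) ≤ n * (1 / (6 * n)) := by field_simp; norm_num
      _ ≤ 1.523 ^ j * |x - p| := mul_le_mul hj hx (by positivity) (by positivity)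
  obtain ⟨hj0, hj1⟩ := iterate_amplify_mem_unit h0 h1 j
  have hesc := iterate_amplify_le_or_ge hp h₁ h₂ hj0 hj1
    (le_abs_iterate_amplify_sub hp h₁ h₂ h0 h1 hgap)
  rw [← Function.iterate_add_apply] at hesc
  obtain ⟨hm0, hm1⟩ := iterate_amplify_mem_unit h0 h1 (160 + j)
  have hside := iterate_amplify_le_fixed_iff hp h₂ h0 h1 (160 + j)
  have hsmall : ((1 : ℝ) / 4) ^ 2 ^ i < 4 * (1 / 2) ^ n := by
    calc ((1 : ℝ) / 4) ^ 2 ^ i ≤ (1 / 4) ^ n :=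
          pow_le_pow_of_le_one (by norm_num) (by norm_num) hi
      _ ≤ (1 / 2) ^ n := pow_le_pow_left₀ (by norm_num) (by norm_num) n
      _ < 4 * (1 / 2) ^ n := lt_mul_of_one_lt_left (by positivity) (by norm_num)
  rw [Function.iterate_add_apply]
  refine ⟨fun hxp => ?_, fun hxp => ?_⟩
  · have hm := hside.2 hxp
    have := (amplify_iterate_small hm0 (hesc.resolve_right (by linarith)) i).2
    linarith
  · have hm := not_le.1 (mt hside.1 hxp.not_ge)
    have := (amplify_iterate_large hm1 (hesc.resolve_left (by linarith)) i).2
    linarith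

theorem exists_amplify_fixed : ∃ p : ℝ, p ^ 2 = 3 * p - 1 ∧ 0.3819 < p ∧ p < 0.382 := by
  have h := Real.sq_sqrt (show (0 : ℝ) ≤ 5 by norm_num)
  have h0 := Real.sqrt_nonneg 5
  exact ⟨(3 - √5) / 2, by nlinarith, by nlinarith, by nlinarith⟩

/-! ### Shallow formulas for threshold functions -/

/-- **Valiant.** Every threshold function on `n` variables has a monotone formula of depth
`2 (i + j)` up to a constant, where `n ≤ 2 ^ i` and `n ≤ 1.523 ^ j`. -/
theorem MonotoneFormula.exists_threshold {V : Type u} [Fintype V] [Nonempty V] {k i j : ℕ}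
    (hk : 1 ≤ k) (hkn : k ≤ Fintype.card V) (hj : (Fintype.card V : ℝ) ≤ 1.523 ^ j)
    (hi : Fintype.card V ≤ 2 ^ i) :
    ∃ φ : MonotoneFormula V, φ.depth ≤ 2 * (i + (160 + j)) ∧ ∀ x, φ.Accepts x ↔ k ≤ x.card := by
  obtain ⟨p, hp, h₁, h₂⟩ := exists_amplify_fixed
  obtain ⟨R, hR, hprob⟩ := RandomFormula.exists_acceptProb_eq (V := V) (p := p) (by linarith)
    (by linarith) hk hkn
  obtain ⟨S, hd, hS⟩ := R.exists_iterate_amplify hR (i + (160 + j))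
  have hn : (0 : ℝ) < Fintype.card V := by exact_mod_cast Fintype.card_pos
  have key : ∀ x : Finset V, (1 / (6 * Fintype.card V) ≤ |R.acceptProb x - p|) ∧
      (k ≤ x.card ↔ p < R.acceptProb x) := by
    intro x
    rw [hprob, add_sub_cancel_left, lt_add_iff_pos_right, abs_div,
      abs_of_pos (show (0 : ℝ) < 3 * Fintype.card V by positivity),
      div_pos_iff_of_pos_right (by positivity), div_le_div_iff₀ (by positivity) (by positivity)]
    rcases le_or_gt k x.card with h | h
    · have h' : (k : ℝ) ≤ x.card := by exact_mod_cast h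
      refine ⟨?_, iff_of_true h (by linarith)⟩
      rw [abs_of_nonneg (by linarith)]
      nlinarith
    · have h' : (x.card : ℝ) + 1 ≤ k := by exact_mod_cast h
      refine ⟨?_, iff_of_false h.not_ge (by linarith)⟩
      rw [abs_of_nonpos (by linarith)]
      nlinarith
  have hext := fun x => iterate_amplify_extreme hp h₁ h₂ (R.acceptProb_nonneg x)
    (R.acceptProb_le_one x) Fintype.card_pos (key x).1 hj hi
  obtain ⟨ω, hω⟩ := S.exists_forall_accepts_iff (fun x => k ≤ x.card)
    (fun x hx => by rw [hS]; exact (hext x).2 ((key x).2.1 hx))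
    (fun x hx => by rw [hS]; exact (hext x).1 (not_lt.1 (mt (key x).2.2 hx)))
  exact ⟨S.formula ω, hd ω, hω⟩

/-! ### The protocol for the biclique game -/

namespace SimpleGraph

variable {V : Type u} [Fintype V]

theorem IsBicliquePair.card_le_bicliqueNumber {G : SimpleGraph V} {a b : Finset V}
    (h : G.IsBicliquePair a b) : a.card + b.card ≤ G.bicliqueNumber := by
  refine le_csSup ⟨Fintype.card V + Fintype.card V, ?_⟩ ⟨a, b, h, rfl⟩
  rintro m ⟨a', b', -, rfl⟩
  exact add_le_add (Finset.card_le_univ _) (Finset.card_le_univ _)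

open Classical in
/-- The vertices adjacent to all vertices of `b`. -/
noncomputable def commonNeighborFinset (G : SimpleGraph V) (b : Finset V) : Finset V :=
  Finset.univ.filter fun u => ∀ v ∈ b, G.Adj u v

/-- The sets of a promised pair satisfy `|N(b)| < |a|`: otherwise `N(b)` and `b` would form a
biclique that is too large. -/
theorem card_commonNeighborFinset_lt {G : SimpleGraph V} {a b : Finset V}
    (h : G.bicliqueGame.Promise a b) : (G.commonNeighborFinset b).card < a.card := by
  obtain ⟨ha, hb, -, hcard⟩ := h
  by_contra! hle
  have hadj : ∀ u ∈ G.commonNeighborFinset b, ∀ v ∈ b, G.Adj u v := fun u hu => by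
    simpa [commonNeighborFinset] using hu
  have hpair : G.IsBicliquePair (G.commonNeighborFinset b) b :=
    ⟨Finset.card_pos.1 (ha.card_pos.trans_le hle), hb,
      Finset.disjoint_left.2 fun u hu hub => G.irrefl (hadj u hu u hub), hadj⟩
  have := hpair.card_le_bicliqueNumber
  omega

open Classical in
/-- Once a vertex `u` of `a` outside `N(b)` is known to both players, Bob only has to name a vertex
of `b` that is not adjacent to `u`. -/
theorem solvableIn_clog_of_mem (G : SimpleGraph V)
    {Γ : CommGame (Finset V) (Finset V) (Sym2 V)} (hΓ : Γ.Goal = G.bicliqueGame.Goal) (u : V)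
    (h : ∀ a b, Γ.Promise a b → u ∈ a ∧ u ∉ G.commonNeighborFinset b) :
    Γ.SolvableIn (Nat.clog 2 (Fintype.card V)) := by
  have hex : ∀ a b, Γ.Promise a b → ∃ v ∈ b, ¬ G.Adj u v := fun a b hab => by
    simpa [commonNeighborFinset] using (h a b hab).2
  rw [← Nat.zero_add (Nat.clog _ _)]
  refine CommGame.SolvableIn.bob_nat _
    (fun b => if hb : ∃ v ∈ b, ¬ G.Adj u v then (Fintype.equivFin V hb.choose : ℕ) else 0)
    (fun a b hab => ?_) fun c => ?_
  · rw [dif_pos (hex a b hab)]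
    exact (Fin.isLt _).trans_le (Nat.le_pow_clog one_lt_two _)
  · by_cases hc : c < Fintype.card V
    · refine CommGame.solvableIn_zero_of_goal s(u, (Fintype.equivFin V).symm ⟨c, hc⟩)
        fun a b hab => ?_
      have hb := hex a b hab.1
      have hcb := hab.2
      beta_reduce at hcb
      rw [dif_pos hb] at hcb
      have hv : (Fintype.equivFin V).symm ⟨c, hc⟩ = hb.choose := by
        rw [Equiv.symm_apply_eq]
        exact Fin.ext hcb.symm
      change Γ.Goal _ _ _
      rw [hΓ, hv]
      exact ⟨u, (h a b hab.1).1, _, hb.choose_spec.1, hb.choose_spec.2, rfl⟩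
    · refine CommGame.solvableIn_zero_of_goal s(u, u) fun a b hab => ?_
      have hcb := hab.2
      beta_reduce at hcb
      rw [dif_pos (hex a b hab.1)] at hcb
      exact absurd (hcb ▸ Fin.isLt _) hc

theorem bicliqueGame_solvableIn [Nonempty V] (G : SimpleGraph V) {j : ℕ}
    (hj : (Fintype.card V : ℝ) ≤ 1.523 ^ j) :
    G.bicliqueGame.SolvableIn (4 * Nat.clog 2 (Fintype.card V) + 2 * j + 320) := by
  have hZ : Nonempty (Sym2 V) := (Nonempty.map fun v => s(v, v)) ‹Nonempty V›
  set d := Nat.clog 2 (Fintype.card V)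
  have hd : Fintype.card V ≤ 2 ^ d := Nat.le_pow_clog one_lt_two _
  have : 4 * d + 2 * j + 320 = d + 2 * (d + (160 + j)) + d := by ring
  rw [this]
  refine CommGame.SolvableIn.alice_nat d Finset.card (fun a b hab => ?_) fun k => ?_
  · -- `a` misses the vertices of the nonempty set `b`
    obtain ⟨-, ⟨v, hv⟩, hdisj, -⟩ := hab
    exact (Finset.card_lt_univ_of_notMem (Finset.disjoint_right.1 hdisj hv)).trans_le hd
  · by_cases hk : 1 ≤ k ∧ k ≤ Fintype.card V
    · obtain ⟨φ, hφd, hφ⟩ := MonotoneFormula.exists_threshold hk.1 hk.2 hj hd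
      refine CommGame.SolvableIn.mono (CommGame.SolvableIn.of_formula φ id G.commonNeighborFinset
        (fun a b hab => (hφ a).2 hab.2.ge) (fun a b hab h => ?_)
        fun u => G.solvableIn_clog_of_mem rfl u fun a b hab => hab.2)
        (Nat.add_le_add_left hφd d)
      have h₁ := (hφ _).1 h
      have h₂ := card_commonNeighborFinset_lt hab.1
      have h₃ := hab.2
      omega
    · refine CommGame.SolvableIn.mono (CommGame.solvableIn_zero_of_goal
        (Classical.arbitrary (Sym2 V)) fun a b hab => absurd ?_ hk) (Nat.zero_le _)
      rw [← hab.2]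
      exact ⟨hab.1.1.card_pos, Finset.card_le_univ _⟩

end SimpleGraph

/-- The exponent of Valiant's bound: `2 / log₂ 1.523 ≤ 3.3`. -/
theorem exists_le_pow_and_le_logb {n : ℕ} (hn : 0 < n) :
    ∃ j : ℕ, (n : ℝ) ≤ 1.523 ^ j ∧ 2 * (j : ℝ) ≤ 3.3 * Real.logb 2 n + 2 := by
  have hn1 : (1 : ℝ) ≤ n := by exact_mod_cast hn
  have hL : 0 ≤ Real.logb 2 n := Real.logb_nonneg one_lt_two hn1
  refine ⟨⌈1.65 * Real.logb 2 n⌉₊, ?_, ?_⟩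
  · have hbase : (20 / 33 : ℝ) ≤ Real.logb 2 1.523 := by
      rw [div_le_iff₀' (by norm_num), ← Nat.cast_ofNat (n := 33), ← Real.logb_pow,
        Real.le_logb_iff_rpow_le one_lt_two (by positivity)]
      norm_num
    have hceil := Nat.le_ceil (1.65 * Real.logb 2 (n : ℝ))
    rw [← Real.logb_le_logb one_lt_two (by linarith) (by positivity), Real.logb_pow]
    nlinarith
  · have := Nat.ceil_lt_add_one (show 0 ≤ 1.65 * Real.logb 2 (n : ℝ) by positivity)
    linarith

theorem theorem1 :
    ∃ C : ℝ, ∀ (V : Type*) [Fintype V] [Nonempty V] (G : SimpleGraph V),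
      (∃ t : ℕ, G.bicliqueGame.complexity ≤ (t : ℕ∞) ∧
        (t : ℝ) ≤ 7.3 * Real.logb 2 (Fintype.card V) + C) ∧
      (∀ V₁ V₂ : Set V, G.IsBipartiteWith V₁ V₂ → V₁ ∪ V₂ = Set.univ →
        ∃ t : ℕ, (G.bipartiteBicliqueGame V₁ V₂).complexity ≤ (t : ℕ∞) ∧
          (t : ℝ) ≤ 7.3 * Real.logb 2 (Fintype.card V) + C) := by
  refine ⟨326, fun V _ _ G => ?_⟩
  have hn : 0 < Fintype.card V := Fintype.card_pos
  obtain ⟨j, hj, hjL⟩ := exists_le_pow_and_le_logb hn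
  have hL : 0 ≤ Real.logb 2 (Fintype.card V) :=
    Real.logb_nonneg one_lt_two (by exact_mod_cast hn)
  have hclog : (Nat.clog 2 (Fintype.card V) : ℝ) ≤ Real.logb 2 (Fintype.card V) + 1 := by
    rw [← Real.natCeil_logb_natCast]
    exact_mod_cast (Nat.ceil_lt_add_one hL).le
  have hsolv := G.bicliqueGame_solvableIn hj
  have hbound : ((4 * Nat.clog 2 (Fintype.card V) + 2 * j + 320 : ℕ) : ℝ) ≤
      7.3 * Real.logb 2 (Fintype.card V) + 326 := by
    push_cast
    linarith
  refine ⟨⟨_, hsolv.complexity_le, hbound⟩, fun V₁ V₂ _ _ => ⟨_, ?_, hbound⟩⟩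
  have hsolv' : (G.bipartiteBicliqueGame V₁ V₂).SolvableIn _ :=
    hsolv.of_imp (fun _ _ h => h.2.2) fun _ _ _ h => h
  exact hsolv'.complexity_le
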